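/- Let $X_1,X_2,\dots$ be independent, identically distributed real random variables with $X_i\ge 0$ almost surely and distribution function $F$. Assume that $F$ is continuous, that $F$ is twice differentiable on $(0,\infty)$, and that $f=F'$ and $f'=F''$ are continuous and bounded on $(0,\infty)$. For $m,n\in\mathbb{N}=\{1,2,\dots\}$ and $y\in\mathbb{R}$, $x\ge 0$ put $$F_n(y)=\frac1n\sum_{i=1}^n \mathbb{I}(X_i\le y),\qquad V_{k,m}(x)=e^{-mx}\frac{(mx)^k}{k!},\qquad S_m(u;x)=\sum_{k=0}^\infty u\!\left(\frac km\right)V_{k,m}(x),\qquad \hat F^S_{m,n}(x)=S_m(F_n;x).$$ Let $x\in(0,\infty)$ be such that $0<F(x)<1$. Then $\hat F^S_{m,n}(x)$ is integrable with $\mathbb{E}[\hat F^S_{m,n}(x)]=S_m(F;x)$ for all $m,n\in\mathbb{N}$, and, as $m,n\to\infty$ jointly without any restriction on their relative rates, $$n^{1/2}\left(\hat F^S_{m,n}(x)-\mathbb{E}[\hat F^S_{m,n}(x)]\right)=n^{1/2}\left(\hat F^S_{m,n}(x)-S_m(F;x)\right)\xrightarrow{D}\mathcal{N}\left(0,\sigma^2(x)\right),\qquad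 \sigma^2(x)=F(x)(1-F(x)).$$ -/

import Mathlib

open MeasureTheory ProbabilityTheory Filter

/-- The Poisson weight `V_{k,m}(x) = e^{-mx} (mx)^k / k!`. -/
noncomputable def szaszWeight (k m : ℕ) (x : ℝ) : ℝ :=
  Real.exp (-((m : ℝ) * x)) * ((m : ℝ) * x) ^ k / (Nat.factorial k : ℝ)

/-- The Szasz-Mirakyan operator `S_m(u; x) = ∑_{k ≥ 0} u(k/m) V_{k,m}(x)`. -/
noncomputable def szaszOperator (m : ℕ) (u : ℝ → ℝ) (x : ℝ) : ℝ :=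
  ∑' k : ℕ, u ((k : ℝ) / (m : ℝ)) * szaszWeight k m x

/-- The series defining the Szasz-Mirakyan operator converges for bounded `u`; in particular it
does for distribution functions and empirical distribution functions. -/
theorem summable_szaszOperator (m : ℕ) {u : ℝ → ℝ} {C : ℝ} (hu : ∀ y, |u y| ≤ C) (x : ℝ) :
    Summable fun k : ℕ => u ((k : ℝ) / (m : ℝ)) * szaszWeight k m x := by
  have h : Summable fun k : ℕ => C * (Real.exp (-((m : ℝ) * x)) *
      (|(m : ℝ) * x| ^ k / (Nat.factorial k : ℝ))) :=
    ((Real.summable_pow_div_factorial |(m : ℝ) * x|).mul_left _).mul_left _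
  refine Summable.of_norm_bounded h fun k => ?_
  have hw : |szaszWeight k m x| =
      Real.exp (-((m : ℝ) * x)) * (|(m : ℝ) * x| ^ k / (Nat.factorial k : ℝ)) := by
    rw [szaszWeight, abs_div, abs_mul, abs_pow, Real.abs_exp, Nat.abs_cast, mul_div_assoc]
  rw [Real.norm_eq_abs, abs_mul, hw]
  exact mul_le_mul_of_nonneg_right (hu _) (by positivity)

/-- The empirical distribution function of the first `n` observations,
`F_n(y) = (1/n) ∑_{i=1}^n 1{X_i ≤ y}` (the observations are numbered from `0`). -/
noncomputable def empiricalCDF {Ω : Type*} (X : ℕ → Ω → ℝ) (n : ℕ) (ω : Ω) (y : ℝ) : ℝ :=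
  (1 / (n : ℝ)) * ∑ i ∈ Finset.range n, (Set.Iic y).indicator (fun _ => (1 : ℝ)) (X i ω)

/-- The Szasz estimator: the Szasz-Mirakyan operator applied to the empirical distribution
function. -/
noncomputable def szaszEstimator {Ω : Type*} (X : ℕ → Ω → ℝ) (m n : ℕ) (x : ℝ) (ω : Ω) : ℝ :=
  szaszOperator m (empiricalCDF X n ω) x

open Set Topology

/-! By linearity the estimator is the sample mean of `szaszKernel m x (X i)`, where `szaszKernel m x
y` is the probability that `N / m ≥ y` for `N` Poisson with mean `m * x`. Chebyshev's inequality for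
`N` shows that this kernel tends to the indicator of `y ≤ x` for every `y ≠ x`. Continuity of `F`
makes `{x}` a null set, so dominated convergence gives convergence in mean square under `μ`
(`tendsto_integral_sq_szaszKernel_sub`).

Replacing the kernel by the indicator changes the normalised sum by a term whose variance is at most
that mean square error, for every `n` (`measure_normalized_sum_ge_le`). The error thus vanishes in
probability as `m → ∞` whatever `n` does, which is why no relation between the rates is needed. The
classical central limit theorem for the indicators and Slutsky's theorem finish the proof. -/

/-! ### Moments of the Poisson weights -/

theorem szaszWeight_nonneg (k m : ℕ) {x : ℝ} (hx : 0 ≤ x) : 0 ≤ szaszWeight k m x := by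
  unfold szaszWeight
  positivity

/-- This recurrence yields each moment from lower ones by an index shift. -/
theorem szaszWeight_succ (k m : ℕ) (x : ℝ) :
    ((k : ℝ) + 1) * szaszWeight (k + 1) m x = m * x * szaszWeight k m x := by
  have : (Nat.factorial k : ℝ) ≠ 0 := by positivity
  have : (k : ℝ) + 1 ≠ 0 := by positivity
  simp only [szaszWeight, Nat.factorial_succ, Nat.cast_mul, Nat.cast_succ, pow_succ]
  field_simp

theorem hasSum_szaszWeight (m : ℕ) (x : ℝ) : HasSum (fun k => szaszWeight k m x) 1 := by
  have h := (NormedSpace.expSeries_div_hasSum_exp (m * x : ℝ)).mul_left (Real.exp (-(m * x)))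
  rw [← Real.exp_eq_exp_ℝ, ← Real.exp_add, neg_add_cancel, Real.exp_zero] at h
  simpa only [szaszWeight, mul_div_assoc] using h

theorem hasSum_mul_szaszWeight (m : ℕ) (x : ℝ) :
    HasSum (fun k : ℕ => (k : ℝ) * szaszWeight k m x) (m * x) := by
  -- The term `k = 0` vanishes, so shifting the index loses nothing.
  rw [← hasSum_nat_add_iff' 1]
  simpa [szaszWeight_succ] using (hasSum_szaszWeight m x).mul_left (m * x)

theorem hasSum_sq_mul_szaszWeight (m : ℕ) (x : ℝ) :
    HasSum (fun k : ℕ => (k : ℝ) ^ 2 * szaszWeight k m x) (m * x * (m * x + 1)) := by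
  rw [← hasSum_nat_add_iff' 1]
  have h := ((hasSum_mul_szaszWeight m x).add (hasSum_szaszWeight m x)).mul_left (m * x)
  convert! h using 1
  · ext k
    have := szaszWeight_succ k m x
    push_cast
    linear_combination ((k : ℝ) + 1) * this
  · simp

/-- The second central moment of the Szasz-Mirakyan weights. -/
theorem hasSum_sub_sq_mul_szaszWeight {m : ℕ} (hm : m ≠ 0) (x : ℝ) :
    HasSum (fun k : ℕ => ((k : ℝ) / m - x) ^ 2 * szaszWeight k m x) (x / m) := by
  have hm' : (m : ℝ) ≠ 0 := by exact_mod_cast hm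
  have h := (((hasSum_sq_mul_szaszWeight m x).mul_left ((m : ℝ) ^ 2)⁻¹).sub
    ((hasSum_mul_szaszWeight m x).mul_left (2 * x / m))).add
    ((hasSum_szaszWeight m x).mul_left (x ^ 2))
  convert! h using 1
  · ext k
    field_simp
    ring
  · field_simp
    ring

/-! ### The kernel and its pointwise limit -/

/-- The Szasz-Mirakyan operator applied to the distribution function of the point mass at `y`. -/
noncomputable def szaszKernel (m : ℕ) (x y : ℝ) : ℝ :=
  szaszOperator m (fun t => (Iic t).indicator (fun _ => (1 : ℝ)) y) x

theorem abs_indicator_one_le_one (s : Set ℝ) (y : ℝ) :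
    |s.indicator (fun _ => (1 : ℝ)) y| ≤ 1 := by
  by_cases h : y ∈ s <;> simp [h]

theorem summable_szaszKernel (m : ℕ) (x y : ℝ) :
    Summable fun k : ℕ =>
      (Iic ((k : ℝ) / m)).indicator (fun _ => (1 : ℝ)) y * szaszWeight k m x :=
  summable_szaszOperator m (u := fun t => (Iic t).indicator (fun _ => (1 : ℝ)) y)
    (fun _ => abs_indicator_one_le_one _ _) x

theorem szaszKernel_nonneg (m : ℕ) {x : ℝ} (hx : 0 ≤ x) (y : ℝ) : 0 ≤ szaszKernel m x y :=
  tsum_nonneg fun k => mul_nonneg (indicator_nonneg (fun _ _ => zero_le_one) _)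
    (szaszWeight_nonneg k m hx)

theorem szaszKernel_le_one (m : ℕ) {x : ℝ} (hx : 0 ≤ x) (y : ℝ) : szaszKernel m x y ≤ 1 := by
  rw [← (hasSum_szaszWeight m x).tsum_eq]
  exact (summable_szaszKernel m x y).tsum_le_tsum (fun k => mul_le_of_le_one_left
    (szaszWeight_nonneg k m hx) (abs_le.1 (abs_indicator_one_le_one _ y)).2)
    (hasSum_szaszWeight m x).summable

theorem antitone_szaszKernel (m : ℕ) {x : ℝ} (hx : 0 ≤ x) : Antitone (szaszKernel m x) := by
  intro y z hyz
  refine (summable_szaszKernel m x z).tsum_le_tsum (fun k => ?_) (summable_szaszKernel m x y)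
  refine mul_le_mul_of_nonneg_right ?_ (szaszWeight_nonneg k m hx)
  by_cases h : z ≤ (k : ℝ) / m
  · simp [h, hyz.trans h]
  · simpa [h] using indicator_nonneg (fun _ _ => zero_le_one) _

theorem measurable_szaszKernel (m : ℕ) {x : ℝ} (hx : 0 ≤ x) : Measurable (szaszKernel m x) :=
  (antitone_szaszKernel m hx).measurable

/-- If the indicators differ, `y` separates `t` from `x`, so `|t - x| ≥ |y - x|`. This is the
pointwise form of Chebyshev's inequality. -/
theorem abs_indicator_Iic_sub_le {t x y : ℝ} (hy : y ≠ x) :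
    |(Iic t).indicator (fun _ => (1 : ℝ)) y - (Iic x).indicator (fun _ => (1 : ℝ)) y| ≤
      (t - x) ^ 2 / (y - x) ^ 2 := by
  have hpos : 0 < (y - x) ^ 2 := by have := sub_ne_zero.2 hy; positivity
  by_cases h1 : y ≤ t <;> by_cases h2 : y ≤ x
  · simp [h1, h2]; positivity
  · simp only [mem_Iic, h1, h2, indicator_of_mem, indicator_of_notMem, not_false_eq_true, sub_zero,
      abs_one]
    rw [one_le_div hpos]
    nlinarith
  · simp only [mem_Iic, h1, h2, indicator_of_mem, indicator_of_notMem, not_false_eq_true, zero_sub,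
      abs_neg, abs_one]
    rw [one_le_div hpos]
    nlinarith
  · simp [h1, h2]; positivity

theorem abs_szaszKernel_sub_indicator_le {m : ℕ} (hm : m ≠ 0) {x y : ℝ} (hx : 0 ≤ x)
    (hy : y ≠ x) :
    |szaszKernel m x y - (Iic x).indicator (fun _ => (1 : ℝ)) y| ≤ x / m / (y - x) ^ 2 := by
  have h1 := (summable_szaszKernel m x y).hasSum.sub
    ((hasSum_szaszWeight m x).mul_left ((Iic x).indicator (fun _ => (1 : ℝ)) y))
  rw [mul_one] at h1
  have h2 := (hasSum_sub_sq_mul_szaszWeight hm x).div_const ((y - x) ^ 2)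
  refine h1.norm_le_of_bounded h2 fun k => ?_
  rw [← sub_mul, norm_mul, Real.norm_eq_abs, Real.norm_of_nonneg (szaszWeight_nonneg k m hx),
    mul_div_right_comm]
  exact mul_le_mul_of_nonneg_right (abs_indicator_Iic_sub_le hy) (szaszWeight_nonneg k m hx)

theorem tendsto_szaszKernel {x y : ℝ} (hx : 0 ≤ x) (hy : y ≠ x) :
    Tendsto (fun m => szaszKernel m x y) atTop
      (𝓝 ((Iic x).indicator (fun _ => (1 : ℝ)) y)) := by
  rw [tendsto_iff_norm_sub_tendsto_zero]
  have h : Tendsto (fun m : ℕ => x / m / (y - x) ^ 2) atTop (𝓝 0) := by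
    simpa using (tendsto_const_div_atTop_nhds_zero_nat x).div_const ((y - x) ^ 2)
  refine tendsto_of_tendsto_of_tendsto_of_le_of_le' tendsto_const_nhds h
    (Eventually.of_forall fun _ => norm_nonneg _) ?_
  filter_upwards [eventually_ne_atTop 0] with m hm
  exact abs_szaszKernel_sub_indicator_le hm hx hy

theorem szaszEstimator_eq {Ω : Type*} (X : ℕ → Ω → ℝ) (m n : ℕ) (x : ℝ) (ω : Ω) :
    szaszEstimator X m n x ω = (1 / (n : ℝ)) * ∑ i ∈ Finset.range n, szaszKernel m x (X i ω) := by
  simp only [szaszEstimator, szaszOperator, empiricalCDF, szaszKernel, mul_assoc,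
    Finset.sum_mul, tsum_mul_left]
  rw [Summable.tsum_finsetSum fun i _ => summable_szaszKernel m x (X i ω)]

/-! ### Integrals of the kernel under the common law -/

section Law

variable (μ : Measure ℝ) [IsProbabilityMeasure μ]

theorem integral_szaszKernel (m : ℕ) {x : ℝ} (hx : 0 ≤ x) :
    ∫ y, szaszKernel m x y ∂μ = szaszOperator m (cdf μ) x := by
  have hint (k : ℕ) : Integrable (fun y =>
      (Iic ((k : ℝ) / m)).indicator (fun _ => (1 : ℝ)) y * szaszWeight k m x) μ :=
    ((integrable_const (1 : ℝ)).indicator measurableSet_Iic).mul_const _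
  have hval (k : ℕ) : ∫ y, (Iic ((k : ℝ) / m)).indicator (fun _ => (1 : ℝ)) y * szaszWeight k m x ∂μ
      = cdf μ ((k : ℝ) / m) * szaszWeight k m x := by
    rw [integral_mul_const, integral_indicator measurableSet_Iic, cdf_eq_real]
    simp
  have hs : Summable fun k : ℕ => cdf μ ((k : ℝ) / m) * szaszWeight k m x :=
    summable_szaszOperator m (C := 1)
      (fun y => abs_le.2 ⟨by linarith [cdf_nonneg μ y], cdf_le_one μ y⟩) x
  have h := hasSum_integral_of_summable_integral_norm hint (by
    refine hs.congr fun k => ?_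
    rw [← hval]
    refine integral_congr_ae (Eventually.of_forall fun y => ?_)
    exact (Real.norm_of_nonneg (mul_nonneg (indicator_nonneg (fun _ _ => zero_le_one) _)
      (szaszWeight_nonneg k m hx))).symm)
  rw [szaszOperator, ← tsum_congr hval]
  exact h.tsum_eq.symm

/-- The mass of a point is the jump of the distribution function there. -/
theorem measure_singleton_eq_zero_of_continuous_cdf (hcont : Continuous (cdf μ)) (x : ℝ) :
    μ {x} = 0 := by
  rw [← measure_cdf μ, StieltjesFunction.measure_singleton, hcont.continuousWithinAt.leftLim_eq]
  simp

theorem tendsto_integral_sq_szaszKernel_sub {x : ℝ} (hx : 0 ≤ x) (hatom : μ {x} = 0) :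
    Tendsto (fun m => ∫ y, (szaszKernel m x y - (Iic x).indicator (fun _ => (1 : ℝ)) y) ^ 2 ∂μ)
      atTop (𝓝 0) := by
  have hind : Measurable ((Iic x).indicator fun _ => (1 : ℝ)) :=
    measurable_const.indicator measurableSet_Iic
  have h := tendsto_integral_of_dominated_convergence (μ := μ)
    (F := fun m y => (szaszKernel m x y - (Iic x).indicator (fun _ => (1 : ℝ)) y) ^ 2)
    (f := fun _ => 0) (fun _ => 1)
    (fun m => (((measurable_szaszKernel m hx).sub hind).pow_const 2).aestronglyMeasurable)
    (integrable_const 1)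
    (fun m => Eventually.of_forall fun y => by
      rw [Real.norm_of_nonneg (sq_nonneg _), sq_le_one_iff_abs_le_one, abs_le]
      have h1 := szaszKernel_nonneg m hx y
      have h2 := szaszKernel_le_one m hx y
      have h3 := (abs_le.1 (abs_indicator_one_le_one (Iic x) y)).2
      have h4 : 0 ≤ (Iic x).indicator (fun _ => (1 : ℝ)) y :=
        indicator_nonneg (fun _ _ => zero_le_one) _
      constructor <;> linarith)
    (by
      filter_upwards [compl_mem_ae_iff.2 hatom] with y hy
      simpa using ((tendsto_szaszKernel hx hy).sub_const
        ((Iic x).indicator (fun _ => (1 : ℝ)) y)).pow 2)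
  simpa using h

end Law

/-! ### Normalised sums over the sample -/

section Sample

variable {Ω : Type*} [MeasurableSpace Ω] {P : Measure Ω} [IsProbabilityMeasure P]
  {μ : Measure ℝ} {X : ℕ → Ω → ℝ}

theorem memLp_two_comp_of_bounded (hlaw : ∀ i, HasLaw (X i) μ P) {h : ℝ → ℝ}
    (hh : Measurable h) {C : ℝ} (hC : ∀ y, |h y| ≤ C) (i : ℕ) : MemLp (h ∘ X i) 2 P :=
  MemLp.of_bound (hh.comp_aemeasurable (hlaw i).aemeasurable).aestronglyMeasurable C
    (Eventually.of_forall fun _ => hC _)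

/-- Chebyshev's inequality for the normalised empirical process, uniformly in the sample size. -/
theorem measure_normalized_sum_ge_le (hlaw : ∀ i, HasLaw (X i) μ P) (hindep : iIndepFun X P)
    {h : ℝ → ℝ} (hh : Measurable h) {C : ℝ} (hC : ∀ y, |h y| ≤ C) (n : ℕ) {ε : ℝ} (hε : 0 < ε) :
    P {ω | ε ≤ |(√(n : ℝ))⁻¹ * (∑ i ∈ Finset.range n, h (X i ω) - n * ∫ y, h y ∂μ)|} ≤
      ENNReal.ofReal ((∫ y, h y ^ 2 ∂μ) / ε ^ 2) := by
  have hL := memLp_two_comp_of_bounded hlaw hh hC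
  have hmean (i : ℕ) : ∫ ω, h (X i ω) ∂P = ∫ y, h y ∂μ :=
    (hlaw i).integral_comp hh.aestronglyMeasurable
  have hvar (i : ℕ) : Var[h ∘ X i; P] ≤ ∫ y, h y ^ 2 ∂μ := by
    refine (variance_le_expectation_sq (hL i).aestronglyMeasurable).trans_eq ?_
    exact (hlaw i).integral_comp (hh.pow_const 2).aestronglyMeasurable
  have hsumL : MemLp (fun ω => (√(n : ℝ))⁻¹ * (∑ i ∈ Finset.range n, h ∘ X i) ω) 2 P :=
    (memLp_finsetSum' _ fun i _ => hL i).const_mul _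
  have hsummean : ∫ ω, (√(n : ℝ))⁻¹ * (∑ i ∈ Finset.range n, h ∘ X i) ω ∂P =
      (√(n : ℝ))⁻¹ * (n * ∫ y, h y ∂μ) := by
    simp only [Finset.sum_apply]
    rw [integral_const_mul, integral_finsetSum _ fun i _ => (hL i).integrable one_le_two]
    simp [hmean]
  have hsumvar : Var[fun ω => (√(n : ℝ))⁻¹ * (∑ i ∈ Finset.range n, h ∘ X i) ω; P] ≤
      ∫ y, h y ^ 2 ∂μ := by
    rw [variance_const_mul, IndepFun.variance_sum (fun i _ => hL i)
      fun i _ j _ hij => (hindep.indepFun hij).comp hh hh]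
    calc (√(n : ℝ))⁻¹ ^ 2 * ∑ i ∈ Finset.range n, Var[h ∘ X i; P]
      _ ≤ (n : ℝ)⁻¹ * (n * ∫ y, h y ^ 2 ∂μ) := by
        rw [inv_pow, Real.sq_sqrt n.cast_nonneg]
        gcongr
        simpa using Finset.sum_le_card_nsmul (Finset.range n) _ _ fun i _ => hvar i
      _ ≤ ∫ y, h y ^ 2 ∂μ := by
        rw [← mul_assoc]
        -- `n⁻¹ * n ≤ 1` also covers `n = 0`.
        exact mul_le_of_le_one_left (integral_nonneg fun y => sq_nonneg _) inv_mul_le_one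
  refine le_trans (le_of_eq ?_) ((meas_ge_le_variance_div_sq hsumL hε).trans
    (ENNReal.ofReal_le_ofReal (by gcongr)))
  rw [hsummean]
  simp [mul_sub]

/-- Normalised empirical processes at functions tending to `0` in mean square tend to `0` in
probability, uniformly in the sample size. -/
theorem tendstoInMeasure_normalized_sum (hlaw : ∀ i, HasLaw (X i) μ P) (hindep : iIndepFun X P)
    {h : ℕ → ℝ → ℝ} (hh : ∀ m, Measurable (h m)) {C : ℝ} (hC : ∀ m y, |h m y| ≤ C)
    (hlim : Tendsto (fun m => ∫ y, h m y ^ 2 ∂μ) atTop (𝓝 0)) (l : Filter ℕ) :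
    TendstoInMeasure P (fun (p : ℕ × ℕ) ω => (√(p.2 : ℝ))⁻¹ *
      (∑ i ∈ Finset.range p.2, h p.1 (X i ω) - p.2 * ∫ y, h p.1 y ∂μ)) (atTop ×ˢ l)
      fun _ => 0 := by
  rw [tendstoInMeasure_iff_norm]
  intro ε hε
  have hbound : Tendsto (fun p : ℕ × ℕ => ENNReal.ofReal ((∫ y, h p.1 y ^ 2 ∂μ) / ε ^ 2))
      (atTop ×ˢ l) (𝓝 0) := by
    have := ENNReal.tendsto_ofReal ((hlim.comp (tendsto_fst (g := l))).div_const (ε ^ 2))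
    simpa using this
  refine tendsto_of_tendsto_of_tendsto_of_le_of_le tendsto_const_nhds hbound
    (fun _ => zero_le) fun p => ?_
  simpa using measure_normalized_sum_ge_le hlaw hindep (hh p.1) (hC p.1) p.2 hε

theorem variance_indicator_Iic [IsProbabilityMeasure μ]
    (hlaw : ∀ i, HasLaw (X i) μ P) (x : ℝ) (i : ℕ) :
    Var[(Iic x).indicator (fun _ => (1 : ℝ)) ∘ X i; P] = cdf μ x * (1 - cdf μ x) := by
  have hind : Measurable ((Iic x).indicator fun _ => (1 : ℝ)) :=
    measurable_const.indicator measurableSet_Iic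
  have hmean : ∫ y, (Iic x).indicator (fun _ => (1 : ℝ)) y ∂μ = cdf μ x := by
    rw [integral_indicator measurableSet_Iic, cdf_eq_real]
    simp
  have hsq : ((Iic x).indicator (fun _ => (1 : ℝ)) ∘ X i) ^ 2 =
      (Iic x).indicator (fun _ => (1 : ℝ)) ∘ X i := by
    ext ω
    by_cases h : X i ω ≤ x <;> simp [h]
  rw [variance_eq_sub (memLp_two_comp_of_bounded hlaw hind (abs_indicator_one_le_one _) i), hsq,
    (hlaw i).integral_comp hind.aestronglyMeasurable, hmean]
  ring

/-- The central limit theorem for the empirical distribution function at a point. -/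
theorem tendstoInDistribution_normalized_indicator [IsProbabilityMeasure μ]
    (hlaw : ∀ i, HasLaw (X i) μ P)
    (hindep : iIndepFun X P) (x : ℝ) :
    TendstoInDistribution (fun (n : ℕ) ω => (√(n : ℝ))⁻¹ *
      (∑ i ∈ Finset.range n, (Iic x).indicator (fun _ => (1 : ℝ)) (X i ω) - n *
        ∫ y, (Iic x).indicator (fun _ => (1 : ℝ)) y ∂μ))
      atTop id (fun _ => P) (gaussianReal 0 (Real.toNNReal (cdf μ x * (1 - cdf μ x)))) := by
  have hind : Measurable ((Iic x).indicator fun _ => (1 : ℝ)) :=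
    measurable_const.indicator measurableSet_Iic
  rw [← (hlaw 0).integral_comp hind.aestronglyMeasurable]
  refine tendstoInDistribution_inv_sqrt_mul_sum_sub
    (X := fun i => (Iic x).indicator (fun _ => (1 : ℝ)) ∘ X i) ?_
    (memLp_two_comp_of_bounded hlaw hind (abs_indicator_one_le_one _) 0)
    (hindep.comp _ fun _ => hind) fun i => ((hlaw i).identDistrib (hlaw 0)).comp hind
  rw [variance_indicator_Iic hlaw]
  exact HasLaw.id

theorem TendstoInDistribution.comp_tendsto {ι κ E : Type*} {Ω' : Type*} [MeasurableSpace Ω']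
    [TopologicalSpace E] [MeasurableSpace E] [OpensMeasurableSpace E] {l : Filter ι}
    {l' : Filter κ} {Y : ι → Ω → E} {Z : Ω' → E} {Q : Measure Ω'} [IsProbabilityMeasure Q]
    (h : TendstoInDistribution Y l Z (fun _ => P) Q) {g : κ → ι} (hg : Tendsto g l' l) :
    TendstoInDistribution (fun k => Y (g k)) l' Z (fun _ => P) Q where
  forall_aemeasurable k := h.forall_aemeasurable (g k)
  aemeasurable_limit := h.aemeasurable_limit
  tendsto := h.tendsto.comp hg

theorem integrable_szaszKernel_comp (hlaw : ∀ i, HasLaw (X i) μ P) (m : ℕ) {x : ℝ} (hx : 0 ≤ x)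
    (i : ℕ) : Integrable (fun ω => szaszKernel m x (X i ω)) P :=
  (memLp_two_comp_of_bounded hlaw (measurable_szaszKernel m hx) (C := 1) (fun y => abs_le.2
    ⟨by linarith [szaszKernel_nonneg m hx y], szaszKernel_le_one m hx y⟩) i).integrable one_le_two

theorem integrable_szaszEstimator (hlaw : ∀ i, HasLaw (X i) μ P) (m n : ℕ) {x : ℝ}
    (hx : 0 ≤ x) : Integrable (szaszEstimator X m n x) P := by
  rw [funext (szaszEstimator_eq X m n x)]
  exact (integrable_finsetSum _ fun i _ => integrable_szaszKernel_comp hlaw m hx i).const_mul _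

theorem integral_szaszEstimator [IsProbabilityMeasure μ]
    (hlaw : ∀ i, HasLaw (X i) μ P) (m : ℕ) {n : ℕ} (hn : n ≠ 0)
    {x : ℝ} (hx : 0 ≤ x) : ∫ ω, szaszEstimator X m n x ω ∂P = szaszOperator m (cdf μ) x := by
  have hmean (i : ℕ) : ∫ ω, szaszKernel m x (X i ω) ∂P = szaszOperator m (cdf μ) x :=
    ((hlaw i).integral_comp (measurable_szaszKernel m hx).aestronglyMeasurable).trans
      (integral_szaszKernel μ m hx)
  simp only [szaszEstimator_eq]
  rw [integral_const_mul, integral_finsetSum _ fun i _ => integrable_szaszKernel_comp hlaw m hx i]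
  have : (n : ℝ) ≠ 0 := by exact_mod_cast hn
  simp [hmean, this]

/-- Asymptotic normality of the Szasz estimator. The sample size and the order of the operator
tend to infinity jointly, and the distribution function needs only be continuous at `x`. -/
theorem tendstoInDistribution_szaszEstimator [IsProbabilityMeasure μ]
    (hlaw : ∀ i, HasLaw (X i) μ P)
    (hindep : iIndepFun X P) {x : ℝ} (hx : 0 ≤ x) (hatom : μ {x} = 0) :
    TendstoInDistribution
      (fun (p : ℕ × ℕ) (ω : Ω) => √(p.2 : ℝ) *
        (szaszEstimator X p.1 p.2 x ω - szaszOperator p.1 (cdf μ) x))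
      (atTop ×ˢ atTop) id (fun _ => P)
      (gaussianReal 0 (Real.toNNReal (cdf μ x * (1 - cdf μ x)))) := by
  set I : ℝ → ℝ := (Iic x).indicator fun _ => (1 : ℝ) with hI
  have hind : Measurable I := measurable_const.indicator measurableSet_Iic
  have hIint : Integrable I μ := (integrable_const (1 : ℝ)).indicator measurableSet_Iic
  have hKint (m : ℕ) : Integrable (szaszKernel m x) μ :=
    -- The sample lemma is applied on `(ℝ, μ)` itself, with every observation the identity.
    integrable_szaszKernel_comp (X := fun _ => id) (fun _ => HasLaw.id) m hx 0
  have hmeas (m : ℕ) : Measurable fun y => szaszKernel m x y - I y :=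
    (measurable_szaszKernel m hx).sub hind
  have hbound (m : ℕ) (y : ℝ) : |szaszKernel m x y - I y| ≤ 2 := by
    have h1 := abs_sub (szaszKernel m x y) (I y)
    rw [abs_of_nonneg (szaszKernel_nonneg m hx y)] at h1
    linarith [szaszKernel_le_one m hx y, abs_indicator_one_le_one (Iic x) y]
  -- The indicator sums do not involve `m`, so their limit in `n` is also a joint limit.
  have hmain := TendstoInDistribution.comp_tendsto
    (tendstoInDistribution_normalized_indicator hlaw hindep x)
    (tendsto_snd (f := (atTop : Filter ℕ)) (g := atTop))
  have hrem := tendstoInMeasure_normalized_sum hlaw hindep hmeas hbound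
    (tendsto_integral_sq_szaszKernel_sub μ hx hatom) atTop
  have h := hmain.add_of_tendstoInMeasure_const hrem fun p =>
    ((Finset.aemeasurable_fun_sum _ fun i _ =>
      (hmeas p.1).comp_aemeasurable (hlaw i).aemeasurable).sub_const _).const_mul _
  refine h.congr (fun p => Eventually.of_forall fun ω => ?_)
    (Eventually.of_forall fun y => add_zero y)
  simp only [Pi.add_apply, ← hI]
  rw [integral_sub (hKint p.1) hIint, integral_szaszKernel μ p.1 hx, szaszEstimator_eq,
    Finset.sum_sub_distrib]
  rcases Nat.eq_zero_or_pos p.2 with h0 | h0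
  · simp [h0]
  · have hpos : (0 : ℝ) < p.2 := by exact_mod_cast h0
    have hs := Real.sq_sqrt hpos.le
    have hs0 : √(p.2 : ℝ) ≠ 0 := (Real.sqrt_pos.2 hpos).ne'
    generalize √(p.2 : ℝ) = s at hs hs0
    rw [← hs]
    field_simp
    ring

end Sample

theorem mainTheorem2 {Ω : Type*} [MeasurableSpace Ω] (P : Measure Ω) [IsProbabilityMeasure P]
    -- the common law `μ` of the observations, carried by `[0, ∞)`
    (μ : Measure ℝ) [IsProbabilityMeasure μ] (hμ : μ (Set.Iio 0) = 0)
    -- the i.i.d. sample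
    (X : ℕ → Ω → ℝ) (hlaw : ∀ i, HasLaw (X i) μ P) (hindep : iIndepFun X P)
    -- regularity of the distribution function `F = cdf μ`
    (hcont : Continuous (cdf μ))
    (f f' : ℝ → ℝ)
    (hf : ∀ y, 0 < y → HasDerivAt (cdf μ) (f y) y)
    (hf' : ∀ y, 0 < y → HasDerivAt f (f' y) y)
    (hf_cont : ContinuousOn f (Set.Ioi 0)) (hf'_cont : ContinuousOn f' (Set.Ioi 0))
    (hf_bdd : ∃ C, ∀ y, 0 < y → |f y| ≤ C) (hf'_bdd : ∃ C, ∀ y, 0 < y → |f' y| ≤ C)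
    (x : ℝ) (hx : 0 < x) (hF0 : 0 < cdf μ x) (hF1 : cdf μ x < 1) :
    (∀ m n : ℕ, 1 ≤ m → 1 ≤ n →
      Integrable (szaszEstimator X m n x) P ∧
        ∫ ω, szaszEstimator X m n x ω ∂P = szaszOperator m (cdf μ) x) ∧
    TendstoInDistribution
      (fun (p : ℕ × ℕ) (ω : Ω) => √(p.2 : ℝ) *
        (szaszEstimator X p.1 p.2 x ω - ∫ ω', szaszEstimator X p.1 p.2 x ω' ∂P))
      (atTop ×ˢ atTop) id (fun _ => P)
      (gaussianReal 0 (Real.toNNReal (cdf μ x * (1 - cdf μ x)))) ∧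
    TendstoInDistribution
      (fun (p : ℕ × ℕ) (ω : Ω) => √(p.2 : ℝ) *
        (szaszEstimator X p.1 p.2 x ω - szaszOperator p.1 (cdf μ) x))
      (atTop ×ˢ atTop) id (fun _ => P)
      (gaussianReal 0 (Real.toNNReal (cdf μ x * (1 - cdf μ x)))) := by
  have hatom := measure_singleton_eq_zero_of_continuous_cdf μ hcont x
  have hlim := tendstoInDistribution_szaszEstimator hlaw hindep hx.le hatom
  refine ⟨fun m n _ hn => ⟨integrable_szaszEstimator hlaw m n hx.le,
    integral_szaszEstimator hlaw m (by omega) hx.le⟩, ?_, hlim⟩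
  refine hlim.congr (fun p => Eventually.of_forall fun ω => ?_) EventuallyEq.rfl
  -- For `n = 0` the mean formula is unavailable, but the factor `√0` annihilates both sides.
  rcases Nat.eq_zero_or_pos p.2 with h0 | h0
  · simp [h0]
  · simp only [integral_szaszEstimator hlaw p.1 h0.ne' hx.le]
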